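/- \textbf{Setting.} Let $\mathcal S=\{S_1,\dots,S_N\}$ be an iterated function system (IFS) of contracting similitudes of $\mathbb R^d$ (that is, $|S_j(x)-S_j(y)|=c_j|x-y|$ with $0<c_j<1$), with invariant set $K$, i.e. $K$ is the non-empty compact set with $K=\bigcup_{j=1}^N S_j(K)$. Suppose that $\mathcal S$ satisfies the open set condition (OSC): there is a non-empty open set $U$ such that the sets $S_1(U),\dots,S_N(U)$ are pairwise disjoint and contained in $U$. Let $A=\{a_1,\dots,a_m\}\subset K$ ($m\ge 1$, the $a_i$ distinct) be a finite skeleton of $\mathcal S$: $A\subset\bigcup_{j}S_j(A)$, and the graph on $\{1,\dots,N\}$ in which $i\neq j$ are joined iff $S_i(A)\cap S_j(A)\ne\emptyset$ is connected. Put $a_{m+1}=a_1$. Let $V=\{v_1,\dots,v_m,v_1^{-1},\dots,v_m^{-1}\}$ be a set of $2m$ distinct abstract directed edges, where $v_j$ goes from $a_j$ to $a_{j+1}$ and $v_j^{-1}$ from $a_{j+1}$ to $a_j$; put $(v_j^{-1})^{-1}=v_j^{1}=v_j$ and $|v_j|=|v_j^{-1}|=v_j$. For $v\in V$ going from $x$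 to $y$, let $S_i(v)$ be an abstract edge from $S_i(x)$ to $S_i(y)$; different pairs $(i,v)$ give different edges. For an orientation vector $\beta\in\{1,-1\}^N$ let $G(\mathcal S,A,\beta)$ be the directed graph with the edges $S_i(v_j^{\beta_i})$, $1\le i\le N$, $1\le j\le m$. Let $P$ be a unicursal path of $G(\mathcal S,A,\beta)$, i.e. a directed path that passes every edge exactly once. Let $P=P_1+\cdots+P_m$ be a consistent partition of it, i.e. $P$ is the concatenation of the paths $P_1,\dots,P_m$, which have pairwise no common edge, and $P_j$ is a path from $a_j$ to $a_{j+1}$ for every $j$. Write $$P_j=S_{j,1}(v_{j,1})\cdots S_{j,\ell_j}(v_{j,\ell_j}),\qquad S_{j,k}\in\mathcal S,\ v_{j,k}\in V .$$ The partition is called primitive if the substitution $\tau^*: v_j\mapsto |v_{j,1}|\cdots|v_{j,\ell_j}|$ over the alphabet $\{v_1,\dots,v_m\}$ is primitive: there is $n\ge1$ such that every letter appears in $(\tau^*)^n(v)$ for every letter $v$. The graph-directed IFS (GIFS) induced by the partition has state set $V$. For $1\le k\le \ell_j$, the $k$-th edge leaving the state $v_j$ leads to the state $v_{j,k}$ and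 carries the similitude $S_{j,k}$; the $k$-th edge leaving $v_j^{-1}$ leads to $v_{j,\ell_j-k+1}^{-1}$ and carries $S_{j,\ell_j-k+1}$. Its invariant sets $\{E_v\}_{v\in V}$ are the non-empty compact sets such that, for all $j$, $$E_{v_j}=\bigcup_{k=1}^{\ell_j}S_{j,k}(E_{v_{j,k}}),\qquad E_{v_j^{-1}}=\bigcup_{k=1}^{\ell_j}S_{j,k}(E_{v_{j,k}^{-1}}).$$ It satisfies the OSC if there are non-empty open sets $\{U_v\}_{v\in V}$ such that, for every state $u$, the sets $g_e(U_{t(e)})$, where $e$ runs over the edges leaving $u$, with similitude $g_e$ and terminal state $t(e)$, are pairwise disjoint and contained in $U_u$. \textbf{Theorem.} If the partition $P=P_1+\cdots+P_m$ is consistent and primitive, then the GIFS induced by it satisfies the OSC, and $0<\mathcal H^s(E_v)<\infty$ for all $v\in V$, where $s=\dim_H K$. -/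

import Mathlib

namespace SpaceFilling

/-- A contracting similitude of `ℝ^d`, with contraction ratio in `(0, 1)`. -/
structure ContractingSimilitude (d : ℕ) where
  toFun : EuclideanSpace ℝ (Fin d) → EuclideanSpace ℝ (Fin d)
  ratio : ℝ
  ratio_pos : 0 < ratio
  ratio_lt_one : ratio < 1
  dist_map : ∀ x y, dist (toFun x) (toFun y) = ratio * dist x y

instance (d : ℕ) : CoeFun (ContractingSimilitude d)
    (fun _ => EuclideanSpace ℝ (Fin d) → EuclideanSpace ℝ (Fin d)) :=
  ⟨ContractingSimilitude.toFun⟩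

/-! ### Iterated function systems and skeletons -/

/-- An iterated function system `S_1, …, S_N` on `ℝ^d`. -/
abbrev IFS (d N : ℕ) : Type := Fin N → ContractingSimilitude d

namespace IFS

variable {d N : ℕ}

/-- `K` is the invariant set of the IFS. -/
def IsInvariantSet (S : IFS d N) (K : Set (EuclideanSpace ℝ (Fin d))) : Prop :=
  K.Nonempty ∧ IsCompact K ∧ K = ⋃ j, S j '' K

/-- The open set condition for an IFS. -/
def OpenSetCondition (S : IFS d N) : Prop :=
  ∃ U : Set (EuclideanSpace ℝ (Fin d)), IsOpen U ∧ U.Nonempty ∧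
    (⋃ i, S i '' U) ⊆ U ∧ ∀ i j, i ≠ j → Disjoint (S i '' U) (S j '' U)

/-- The Hata graph `H(F)`: the vertices are the maps of the IFS (represented by their indices),
and two different vertices `i`, `j` are joined iff `S_i(F)` meets `S_j(F)`. -/
def hataGraph (S : IFS d N) (F : Set (EuclideanSpace ℝ (Fin d))) : SimpleGraph (Fin N) where
  Adj i j := i ≠ j ∧ (S i '' F ∩ S j '' F).Nonempty
  symm := ⟨fun _ _ h => ⟨h.1.symm, by rw [Set.inter_comm]; exact h.2⟩⟩
  loopless := ⟨fun _ h => h.1 rfl⟩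

/-- `A` is a skeleton of the IFS `S` with invariant set `K`. -/
def IsSkeleton (S : IFS d N) (K A : Set (EuclideanSpace ℝ (Fin d))) : Prop :=
  A ⊆ K ∧ (S.hataGraph A).Connected ∧ A ⊆ ⋃ j, S j '' A

end IFS

/-! ### Graph-directed iterated function systems -/

/-- A graph-directed IFS on `ℝ^d` with state set `V`: a directed multigraph on `V` with finitely
many edges, and a contracting similitude for every edge. -/
structure GIFS (d : ℕ) (V : Type*) where
  Edge : Type
  edge_finite : Finite Edge
  src : Edge → V
  tgt : Edge → V
  map : Edge → ContractingSimilitude d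

/-- An ordered GIFS: the edges carry a (strict) partial order that is linear on the set of edges
leaving any given state, while edges leaving different states are not comparable. -/
structure OrderedGIFS (d : ℕ) (V : Type*) extends GIFS d V where
  prec : Edge → Edge → Prop
  prec_irrefl : ∀ e, ¬ prec e e
  prec_trans : ∀ e f g, prec e f → prec f g → prec e g
  prec_total : ∀ e f, src e = src f → e ≠ f → prec e f ∨ prec f e
  prec_src : ∀ e f, prec e f → src e = src f

namespace GIFS

variable {d : ℕ} {V : Type*}

/-- `E` is the family of invariant sets of the GIFS: nonempty compact sets such that, for every
state `u`, `E_u` is the union of the `g_e(E_{t(e)})` over all edges `e` leaving `u`. -/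
def IsInvariantFamily (G : GIFS d V) (E : V → Set (EuclideanSpace ℝ (Fin d))) : Prop :=
  (∀ u, (E u).Nonempty ∧ IsCompact (E u)) ∧
    ∀ u, E u = ⋃ (e : G.Edge) (_ : G.src e = u), G.map e '' E (G.tgt e)

/-- The open set condition for a GIFS: there are nonempty open sets `U_v` such that, for every
state `u`, the sets `g_e(U_{t(e)})`, `e` an edge leaving `u`, are pairwise disjoint subsets of
`U_u`. -/
def OpenSetCondition (G : GIFS d V) : Prop :=
  ∃ U : V → Set (EuclideanSpace ℝ (Fin d)),
    (∀ v, IsOpen (U v) ∧ (U v).Nonempty) ∧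
    (∀ e, G.map e '' U (G.tgt e) ⊆ U (G.src e)) ∧
    ∀ e f, e ≠ f → G.src e = G.src f →
      Disjoint (G.map e '' U (G.tgt e)) (G.map f '' U (G.tgt f))

end GIFS

/-! ### The loop through the skeleton and its affine copies -/

/-- The `2m` abstract edges `v_i` (coded by `(i, 1)`) and `v_i⁻¹` (coded by `(i, -1)`). -/
abbrev OrientedEdge (m : ℕ) : Type := Fin m × ℤˣ

namespace OrientedEdge

variable {d m : ℕ}

/-- `v_i ↦ v_i⁻¹` and `v_i⁻¹ ↦ v_i`. -/
def rev (v : OrientedEdge m) : OrientedEdge m := (v.1, -v.2)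

/-- The initial point: `a_i` for `v_i`, and `a_{i+1}` for `v_i⁻¹`. Addition in `Fin m` is cyclic,
so that the successor of the last index is the first one. -/
def init [NeZero m] (a : Fin m → EuclideanSpace ℝ (Fin d)) (v : OrientedEdge m) :
    EuclideanSpace ℝ (Fin d) :=
  if v.2 = 1 then a v.1 else a (v.1 + 1)

/-- The terminal point: `a_{i+1}` for `v_i`, and `a_i` for `v_i⁻¹`. -/
def term [NeZero m] (a : Fin m → EuclideanSpace ℝ (Fin d)) (v : OrientedEdge m) :
    EuclideanSpace ℝ (Fin d) :=
  if v.2 = 1 then a (v.1 + 1) else a v.1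

end OrientedEdge

/-- The abstract edges `S_i(v)` of the induced graph, coded by `(i, v)`; edges with different
codes are different, even if they coincide as oriented segments. -/
abbrev CopyEdge (N m : ℕ) : Type := Fin N × OrientedEdge m

section Paths

variable {d N m : ℕ} [NeZero m]

/-- The initial point of `S_i(v)`. -/
def CopyEdge.init (S : IFS d N) (a : Fin m → EuclideanSpace ℝ (Fin d)) (e : CopyEdge N m) :
    EuclideanSpace ℝ (Fin d) :=
  S e.1 (OrientedEdge.init a e.2)

/-- The terminal point of `S_i(v)`. -/
def CopyEdge.term (S : IFS d N) (a : Fin m → EuclideanSpace ℝ (Fin d)) (e : CopyEdge N m) :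
    EuclideanSpace ℝ (Fin d) :=
  S e.1 (OrientedEdge.term a e.2)

/-- The edge set of `G(S, A, β) = ⋃_j S_j(Λ_0^{β_j})`: the edges `S_j(v_i^{β_j})`. -/
def orientedGraph (β : Fin N → ℤˣ) : Set (CopyEdge N m) :=
  {e | e.2.2 = β e.1}

/-- The list `P` of edges is a path from the point `x` to the point `y`. -/
def IsPathFromTo (S : IFS d N) (a : Fin m → EuclideanSpace ℝ (Fin d)) :
    EuclideanSpace ℝ (Fin d) → List (CopyEdge N m) → EuclideanSpace ℝ (Fin d) → Prop
  | x, [], y => x = y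
  | x, e :: P, y => CopyEdge.init S a e = x ∧ IsPathFromTo S a (CopyEdge.term S a e) P y

/-- `P` is a unicursal path of `G(S, A, β)`: a path that passes every edge exactly once. -/
def IsUnicursalPath (S : IFS d N) (a : Fin m → EuclideanSpace ℝ (Fin d)) (β : Fin N → ℤˣ)
    (P : List (CopyEdge N m)) : Prop :=
  (∃ x y, IsPathFromTo S a x P y) ∧ P.Nodup ∧ ∀ e, e ∈ P ↔ e ∈ orientedGraph β

/-- `P = P_1 + ⋯ + P_m` is a consistent partition of the unicursal path `P` of `G(S, A, β)`: the
paths `P_i` have no edge in common, and `P_i` leads from `a_i` to `a_{i+1}`. -/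
structure IsConsistentPartition (S : IFS d N) (a : Fin m → EuclideanSpace ℝ (Fin d))
    (β : Fin N → ℤˣ) (P : List (CopyEdge N m)) (Q : Fin m → List (CopyEdge N m)) : Prop where
  unicursal : IsUnicursalPath S a β P
  eq_concat : P = (List.ofFn Q).flatten
  disjoint : ∀ i j, i ≠ j → (Q i).Disjoint (Q j)
  consistent : ∀ i, IsPathFromTo S a (a i) (Q i) (a (i + 1))

end Paths

/-! ### Substitutions and the induced GIFS -/

/-- A substitution `σ` over an alphabet is primitive if for some `n ≥ 1` all letters appear in
`σ^n(v)`, for every letter `v`. -/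
def IsPrimitiveSubstitution {α : Type*} (σ : α → List α) : Prop :=
  ∃ n : ℕ, 1 ≤ n ∧ ∀ u v : α, u ∈ (fun w : List α => w.flatMap σ)^[n] [v]

section Induced

variable {d N m : ℕ}

/-- The reverse path: the edges `S_i(v)` are replaced by `S_i(v⁻¹)`, in the reverse order. -/
def reversePath (P : List (CopyEdge N m)) : List (CopyEdge N m) :=
  (P.map fun e => (e.1, e.2.rev)).reverse

/-- The fine substitution rule `τ : v_j ↦ P_j, v_j⁻¹ ↦ P_j⁻¹`. -/
def fineSubstitution (Q : Fin m → List (CopyEdge N m)) (v : OrientedEdge m) :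
    List (CopyEdge N m) :=
  if v.2 = 1 then Q v.1 else reversePath (Q v.1)

/-- The coarse substitution `τ* : v_j ↦ |v_{j,1}| ⋯ |v_{j,ℓ_j}|` over `{v_1, …, v_m}`. -/
def coarseSubstitution (Q : Fin m → List (CopyEdge N m)) (j : Fin m) : List (Fin m) :=
  (Q j).map fun e => e.2.1

/-- The partition `P_1 + ⋯ + P_m` is primitive. -/
def IsPrimitivePartition (Q : Fin m → List (CopyEdge N m)) : Prop :=
  IsPrimitiveSubstitution (coarseSubstitution Q)

/-- The (ordered) GIFS induced by the partition `P_1 + ⋯ + P_m`. The states are the `v_j` and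
`v_j⁻¹`. If the `k`-th edge of the path `τ(u)` is `S_i(v)`, then the `k`-th edge leaving the
state `u` leads to the state `v` and its similitude is `S_i`. -/
def inducedGIFS (S : IFS d N) (Q : Fin m → List (CopyEdge N m)) :
    OrderedGIFS d (OrientedEdge m) where
  Edge := Σ u : OrientedEdge m, Fin (fineSubstitution Q u).length
  edge_finite := inferInstance
  src b := b.1
  tgt b := ((fineSubstitution Q b.1).get b.2).2
  map b := S ((fineSubstitution Q b.1).get b.2).1
  prec b c := b.1 = c.1 ∧ b.2.val < c.2.val
  prec_irrefl _ h := lt_irrefl _ h.2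
  prec_trans b c e h h' := ⟨h.1.trans h'.1, h.2.trans h'.2⟩
  prec_total := by
    rintro ⟨u, k⟩ ⟨v, l⟩ (rfl : u = v) hne
    rcases lt_trichotomy k.val l.val with h | h | h
    · exact Or.inl ⟨rfl, h⟩
    · exact absurd (by rw [Fin.ext h]) hne
    · exact Or.inr ⟨rfl, h⟩
  prec_src b c h := h.1

end Induced

end SpaceFilling

open SpaceFilling
open scoped NNReal MeasureTheory

/-!
An edge of the induced GIFS is determined by its terminal state `v` and the index `i` of its
similitude `S_i`, and all pairs `(i, v)` occur. Hence a path is determined by its terminal state and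
its word over the IFS, and the OSC of the IFS bounds the number of cylinders of a given scale that
come close to a given point. Consider a cylinder for which the number of such neighbours is maximal.
As the GIFS is irreducible up to the reversal `v ↦ v⁻¹`, the maximum is the same along every edge,
so that each image of this cylinder only has the images of its neighbours as neighbours. Therefore
cylinders that start with different edges stay apart, at a distance comparable with their size, from
the images of maximal cylinders, and small balls around the maximal cylinders yield the OSC.

By uniqueness of invariant sets, `K = ⋃ E_v` and `E_v = E_{v⁻¹}`. So some `E_v` has positive measure
as soon as `K` does, and by irreducibility all of them do. That `0 < H^s(K) < ∞` is Hutchinson's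
theorem: the Bernoulli measure with weights `c_i^s` is a mass distribution on `K`.
-/

namespace SpaceFilling

open Set Metric Filter Topology MeasureTheory
open scoped ENNReal

theorem subset_of_forall_exists_lipschitzWith {X V : Type*} [PseudoMetricSpace X] [Finite V]
    {c : ℝ≥0} (hc : c < 1) {E F : V → Set X} (hE : ∀ u, Bornology.IsBounded (E u))
    (hFne : ∀ u, (F u).Nonempty) (hF : ∀ u, IsClosed (F u))
    (h : ∀ u, ∀ x ∈ E u, ∃ v, ∃ f : X → X,
      LipschitzWith c f ∧ x ∈ f '' E v ∧ MapsTo f (F v) (F u)) (u : V) :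
    E u ⊆ F u := by
  set D : ℝ≥0∞ := ⨆ v, ⨆ x ∈ E v, infEDist x (F v)
  have le_D : ∀ v, ∀ x ∈ E v, infEDist x (F v) ≤ D := fun v x hx =>
    (le_iSup₂ (f := fun x (_ : x ∈ E v) => infEDist x (F v)) x hx).trans
      (le_iSup (fun v => ⨆ x ∈ E v, infEDist x (F v)) v)
  have D_ne_top : D ≠ ⊤ := by
    refine iSup_ne_top fun v => ?_
    obtain ⟨z, hz⟩ := hFne v
    obtain ⟨R, hR⟩ := (hE v).subset_closedBall z
    refine ((iSup₂_le fun x hx => ?_).trans_lt (ENNReal.ofReal_lt_top (r := R))).ne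
    exact (infEDist_le_edist_of_mem hz).trans
      ((edist_dist x z).trans_le (ENNReal.ofReal_le_ofReal (hR hx)))
  have D_le : D ≤ c * D := by
    refine iSup_le fun v => iSup₂_le fun x hx => ?_
    obtain ⟨w, f, hf, ⟨y, hy, rfl⟩, hmaps⟩ := h v x hx
    calc infEDist (f y) (F v) ≤ ⨅ z ∈ F w, c * edist y z :=
          le_iInf₂ fun z hz => (infEDist_le_edist_of_mem (hmaps hz)).trans (hf y z)
      _ = c * infEDist y (F w) := by
          rw [infEDist, iInf_subtype', iInf_subtype', ENNReal.mul_iInf' (by simp)]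
          exact fun _ => (hFne w).to_subtype
      _ ≤ c * D := by gcongr; exact le_D w y hy
  have D_eq_zero : D = 0 := by
    by_contra hne
    refine D_le.not_gt ?_
    simpa using ENNReal.mul_lt_mul_left hne D_ne_top (ENNReal.coe_lt_one_iff.2 hc)
  exact fun x hx => (mem_iff_infEDist_zero_of_closed (hF u)).2
    (nonpos_iff_eq_zero.1 (D_eq_zero ▸ le_D u x hx))

theorem exists_encard_le_of_pairwise_le_dist (X : Type*) [NormedAddCommGroup X] [NormedSpace ℝ X]
    [ProperSpace X] (R : ℝ) {δ : ℝ} (hδ : 0 < δ) :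
    ∃ C : ℕ, ∀ (x : X) {r : ℝ}, 0 < r → ∀ s ⊆ closedBall x (r * R),
      (s.Pairwise fun y z => r * δ ≤ dist y z) → s.encard ≤ C := by
  obtain ⟨ε, hε, hεδ⟩ : ∃ ε : ℝ≥0, ε ≠ 0 ∧ 2 * (ε : ℝ) < δ :=
    ⟨(δ / 3).toNNReal, by simpa using hδ, by rw [Real.coe_toNNReal _ (by positivity)]; linarith⟩
  have hfin : externalCoveringNumber ε (closedBall (0 : X) R) ≠ ⊤ := by
    obtain ⟨t, -, htf, ht⟩ :=
      exists_finite_isCover_of_isCompact hε (isCompact_closedBall (0 : X) R)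
    exact (ht.externalCoveringNumber_le_encard.trans_lt htf.encard_lt_top).ne
  lift externalCoveringNumber ε (closedBall (0 : X) R) to ℕ using hfin with C hC
  refine ⟨C, fun x r hr s hs hsep => ?_⟩
  let rescale : X → X := fun y => r⁻¹ • (y - x)
  have dist_rescale : ∀ y z, dist (rescale y) (rescale z) = r⁻¹ * dist y z := fun y z => by
    rw [dist_smul₀, dist_sub_right, Real.norm_of_nonneg (inv_nonneg.2 hr.le)]
  have rescale_inj : Function.Injective rescale :=
    (smul_right_injective X (inv_ne_zero hr.ne')).comp (sub_left_injective (b := x))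
  rw [← rescale_inj.encard_image, hC]
  refine (IsSeparated.encard_le_packingNumber ?_ ?_).trans
    (packingNumber_two_mul_le_externalCoveringNumber ε _)
  · rintro _ ⟨y, hy, rfl⟩
    rw [mem_closedBall, ← show rescale x = 0 by simp [rescale], dist_rescale,
      inv_mul_le_iff₀ hr]
    exact hs hy
  · rintro _ ⟨y, hy, rfl⟩ _ ⟨z, hz, rfl⟩ hne
    have hyz := (le_inv_mul_iff₀ hr).2 (hsep hy hz (ne_of_apply_ne rescale hne))
    rw [edist_dist, dist_rescale, ENNReal.lt_ofReal_iff_toReal_lt (by finiteness)]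
    simpa using hεδ.trans_le hyz

theorem le_mul_hausdorffMeasure_of_closedBall_le {X : Type*} [MetricSpace X] [MeasurableSpace X]
    [BorelSpace X] (m : OuterMeasure X) {C : ℝ≥0∞} (hC0 : C ≠ 0) (hC : C ≠ ⊤) {s : ℝ}
    (h : ∀ x r, 0 < r → r ≤ 1 → m (closedBall x r) ≤ C * ENNReal.ofReal r ^ s) (A : Set X) :
    m A ≤ C * μH[s] A := by
  have m_le : ∀ B : Set X, ediam B < 1 → B.Nonempty → m B ≤ C * ediam B ^ s := by
    rintro B hB ⟨x, hx⟩
    have bound : ∀ᶠ t in 𝓝[>] ediam B, m B ≤ C * t ^ s := by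
      filter_upwards [Ioo_mem_nhdsGT hB] with t ht
      have ht_top : t ≠ ⊤ := (ht.2.trans ENNReal.one_lt_top).ne
      calc m B ≤ m (closedBall x t.toReal) := m.mono fun y hy => by
            rw [mem_closedBall, ← edist_le_ofReal ENNReal.toReal_nonneg,
              ENNReal.ofReal_toReal ht_top]
            exact (edist_le_ediam_of_mem hy hx).trans ht.1.le
        _ ≤ C * ENNReal.ofReal t.toReal ^ s := by
            refine h x _ (ENNReal.toReal_pos (pos_of_gt ht.1).ne' ht_top) ?_
            exact ENNReal.toReal_le_of_le_ofReal zero_le_one (by simpa using ht.2.le)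
        _ = C * t ^ s := by rw [ENNReal.ofReal_toReal ht_top]
    have : (𝓝[>] ediam B).NeBot := nhdsGT_neBot_of_exists_gt ⟨1, hB⟩
    refine ge_of_tendsto (Tendsto.mono_left ?_ nhdsWithin_le_nhds) bound
    exact ENNReal.Tendsto.const_mul (ENNReal.continuous_rpow_const.tendsto _) (Or.inr hC)
  have smul_le : C⁻¹ • m ≤ OuterMeasure.mkMetric fun r : ℝ≥0∞ => r ^ s := by
    refine OuterMeasure.le_mkMetric _ _ 2⁻¹ (by simp) fun B hB => ?_
    rcases B.eq_empty_or_nonempty with rfl | hne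
    · simp
    rw [smul_apply, smul_eq_mul, ENNReal.inv_mul_le_iff hC0 hC]
    exact m_le B (hB.trans_lt ENNReal.one_half_lt_one) hne
  rw [Measure.hausdorffMeasure, ← OuterMeasure.coe_mkMetric, ← ENNReal.inv_mul_le_iff hC0 hC]
  exact smul_le A

theorem bijective_sigma_get {V α : Type*} {L : V → List α} (hnodup : ∀ u, (L u).Nodup)
    (hL : ∀ a, ∃! u, a ∈ L u) :
    Function.Bijective fun b : Σ u, Fin (L u).length => (L b.1).get b.2 := by
  constructor
  · rintro ⟨u, k⟩ ⟨v, l⟩ h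
    obtain rfl : u = v := (hL ((L u).get k)).unique (List.get_mem _ _)
      (by rw [show (L u).get k = (L v).get l from h]; exact List.get_mem _ _)
    exact congrArg (Sigma.mk u) ((hnodup u).injective_get h)
  · intro a
    obtain ⟨u, hu, -⟩ := hL a
    obtain ⟨k, hk⟩ := List.mem_iff_get.1 hu
    exact ⟨⟨u, k⟩, hk⟩

/-! ### Words of contracting similitudes -/

namespace ContractingSimilitude

variable {d : ℕ} (f : ContractingSimilitude d)

theorem lipschitzWith : LipschitzWith f.ratio.toNNReal f :=
  LipschitzWith.of_dist_le_mul fun x y => by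
    rw [f.dist_map, Real.coe_toNNReal _ f.ratio_pos.le]

theorem antilipschitzWith : AntilipschitzWith f.ratio⁻¹.toNNReal f :=
  AntilipschitzWith.of_le_mul_dist fun x y => by
    rw [f.dist_map, Real.coe_toNNReal _ (inv_nonneg.2 f.ratio_pos.le),
      inv_mul_cancel_left₀ f.ratio_pos.ne']

theorem injective : Function.Injective f :=
  f.antilipschitzWith.injective

theorem surjective : Function.Surjective f := by
  have hr := f.ratio_pos
  have isometry : Isometry fun x => f.ratio⁻¹ • f x := Isometry.of_dist_eq fun x y => by
    rw [dist_smul₀, f.dist_map, Real.norm_of_nonneg (inv_nonneg.2 hr.le),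
      inv_mul_cancel_left₀ hr.ne']
  have surj : Function.Surjective fun x => f.ratio⁻¹ • f x :=
    (isometry.affineIsometryOfStrictConvexSpace.toAffineIsometryEquiv rfl).surjective
  intro y
  obtain ⟨x, hx⟩ := surj (f.ratio⁻¹ • y)
  exact ⟨x, smul_right_injective _ (inv_ne_zero hr.ne') hx⟩

end ContractingSimilitude

section Words

variable {d : ℕ} {ι κ : Type*}

/-- The composition `g_{i_1} ∘ ⋯ ∘ g_{i_n}` of the maps along the word `i_1 ⋯ i_n`. -/
def wordMap (g : ι → ContractingSimilitude d) :
    List ι → EuclideanSpace ℝ (Fin d) → EuclideanSpace ℝ (Fin d)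
  | [] => id
  | i :: w => g i ∘ wordMap g w

/-- The contraction ratio of the similitude `wordMap g w`. -/
def wordRatio (g : ι → ContractingSimilitude d) (w : List ι) : ℝ :=
  (w.map fun i => (g i).ratio).prod

/-- The words of the cut set at scale `r`: the shortest words whose ratio is at most `r`. -/
def IsCutWord (g : ι → ContractingSimilitude d) (r : ℝ) (w : List ι) : Prop :=
  wordRatio g w ≤ r ∧ ∀ p, p <+: w → wordRatio g p ≤ r → p = w

/-- The cut words at scale `r` whose cylinder `g_w(K)` meets the closed ball of radius `r`
around `X`. -/
def nearCutWords (g : ι → ContractingSimilitude d) (K : Set (EuclideanSpace ℝ (Fin d)))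
    (X : EuclideanSpace ℝ (Fin d)) (r : ℝ) : Set (List ι) :=
  {w | IsCutWord g r w ∧ (wordMap g w '' K ∩ closedBall X r).Nonempty}

variable (g : ι → ContractingSimilitude d)

@[simp]
theorem wordRatio_nil : wordRatio g [] = 1 := rfl

@[simp]
theorem wordRatio_cons (i : ι) (w : List ι) :
    wordRatio g (i :: w) = (g i).ratio * wordRatio g w :=
  List.prod_cons

theorem wordRatio_append (u w : List ι) :
    wordRatio g (u ++ w) = wordRatio g u * wordRatio g w := by
  simp only [wordRatio, List.map_append, List.prod_append]

theorem wordRatio_map (g : κ → ContractingSimilitude d) (f : ι → κ) (w : List ι) :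
    wordRatio g (w.map f) = wordRatio (g ∘ f) w := by
  simp only [wordRatio, List.map_map, Function.comp_def]

theorem wordRatio_pos (w : List ι) : 0 < wordRatio g w :=
  List.prod_pos (by simpa using fun i _ => (g i).ratio_pos)

theorem wordRatio_le_pow {c : ℝ} (hc0 : 0 ≤ c) (hc : ∀ i, (g i).ratio ≤ c) (w : List ι) :
    wordRatio g w ≤ c ^ w.length := by
  induction w with
  | nil => simp
  | cons i w ih =>
    rw [wordRatio_cons, List.length_cons, pow_succ']
    exact mul_le_mul (hc i) ih (wordRatio_pos g w).le hc0

theorem wordRatio_le_one (w : List ι) : wordRatio g w ≤ 1 := by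
  simpa using wordRatio_le_pow g zero_le_one (fun i => (g i).ratio_lt_one.le) w

theorem wordMap_append (u w : List ι) : wordMap g (u ++ w) = wordMap g u ∘ wordMap g w := by
  induction u with
  | nil => rfl
  | cons i u ih => rw [List.cons_append, wordMap, ih, wordMap, Function.comp_assoc]

theorem wordMap_map (g : κ → ContractingSimilitude d) (f : ι → κ) (w : List ι) :
    wordMap g (w.map f) = wordMap (g ∘ f) w := by
  induction w with
  | nil => rfl
  | cons i w ih => rw [List.map_cons, wordMap, ih]; rfl

theorem dist_wordMap (w : List ι) (x y : EuclideanSpace ℝ (Fin d)) :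
    dist (wordMap g w x) (wordMap g w y) = wordRatio g w * dist x y := by
  induction w with
  | nil => simp [wordMap]
  | cons i w ih =>
    rw [wordMap, Function.comp_apply, Function.comp_apply, (g i).dist_map, ih, wordRatio_cons,
      mul_assoc]

theorem lipschitzWith_wordMap (w : List ι) :
    LipschitzWith (wordRatio g w).toNNReal (wordMap g w) :=
  LipschitzWith.of_dist_le_mul fun x y => by
    rw [dist_wordMap, Real.coe_toNNReal _ (wordRatio_pos g w).le]

theorem wordMap_surjective (w : List ι) : Function.Surjective (wordMap g w) := by
  induction w with
  | nil => exact Function.surjective_id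
  | cons i w ih => exact (g i).surjective.comp ih

theorem ball_subset_wordMap_image (w : List ι) (z : EuclideanSpace ℝ (Fin d)) (ρ : ℝ) :
    ball (wordMap g w z) (wordRatio g w * ρ) ⊆ wordMap g w '' ball z ρ := by
  intro y hy
  obtain ⟨x, rfl⟩ := wordMap_surjective g w y
  rw [mem_ball, dist_wordMap] at hy
  exact ⟨x, lt_of_mul_lt_mul_left hy (wordRatio_pos g w).le, rfl⟩

theorem mapsTo_wordMap {U : Set (EuclideanSpace ℝ (Fin d))} (hU : ∀ i, MapsTo (g i) U U)
    (w : List ι) : MapsTo (wordMap g w) U U := by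
  induction w with
  | nil => exact mapsTo_id U
  | cons i w ih => exact (hU i).comp ih

theorem disjoint_wordMap_image {U : Set (EuclideanSpace ℝ (Fin d))}
    (hU : ∀ i, MapsTo (g i) U U) (hd : ∀ i j, i ≠ j → Disjoint (g i '' U) (g j '' U))
    {u w : List ι} (huw : ¬ u <+: w) (hwu : ¬ w <+: u) :
    Disjoint (wordMap g u '' U) (wordMap g w '' U) := by
  induction u generalizing w with
  | nil => exact absurd List.nil_prefix huw
  | cons i u ih =>
    cases w with
    | nil => exact absurd List.nil_prefix hwu
    | cons j w =>
      simp only [wordMap, image_comp]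
      rcases eq_or_ne i j with rfl | hij
      · rw [List.prefix_cons_inj] at huw hwu
        exact disjoint_image_of_injective (g i).injective (ih huw hwu)
      · exact (hd i j hij).mono (image_mono (mapsTo_wordMap g hU u).image_subset)
          (image_mono (mapsTo_wordMap g hU w).image_subset)

theorem wordRatio_mul_le_dist {U : Set (EuclideanSpace ℝ (Fin d))}
    (hU : ∀ i, MapsTo (g i) U U) (hd : ∀ i j, i ≠ j → Disjoint (g i '' U) (g j '' U))
    {u w : List ι} (huw : ¬ u <+: w) (hwu : ¬ w <+: u) {z : EuclideanSpace ℝ (Fin d)} (hz : z ∈ U)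
    {ρ : ℝ} (hρ : ball z ρ ⊆ U) :
    wordRatio g u * ρ ≤ dist (wordMap g u z) (wordMap g w z) := by
  by_contra! hlt
  exact disjoint_right.1 (disjoint_wordMap_image g hU hd huw hwu) ⟨z, hz, rfl⟩
    (image_mono hρ (ball_subset_wordMap_image g u z ρ (mem_ball'.2 hlt)))

theorem exists_pos_forall_le_ratio [Finite ι] : ∃ c, 0 < c ∧ c ≤ 1 ∧ ∀ i, c ≤ (g i).ratio := by
  cases isEmpty_or_nonempty ι
  · exact ⟨1, one_pos, le_rfl, isEmptyElim⟩
  · obtain ⟨i, hi⟩ := Finite.exists_min fun i => (g i).ratio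
    exact ⟨_, (g i).ratio_pos, (g i).ratio_lt_one.le, hi⟩

theorem exists_lt_one_forall_ratio_le [Finite ι] : ∃ c, 0 ≤ c ∧ c < 1 ∧ ∀ i, (g i).ratio ≤ c := by
  cases isEmpty_or_nonempty ι
  · exact ⟨0, le_rfl, one_pos, isEmptyElim⟩
  · obtain ⟨i, hi⟩ := Finite.exists_max fun i => (g i).ratio
    exact ⟨_, (g i).ratio_pos.le, (g i).ratio_lt_one, hi⟩

theorem exists_isCutWord_prefix {r : ℝ} {w : List ι} (hw : wordRatio g w ≤ r) :
    ∃ p, p <+: w ∧ IsCutWord g r p := by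
  obtain ⟨p, ⟨hpw, hpr⟩, hmin⟩ := exists_minimalFor_of_wellFoundedLT
    (fun p => p <+: w ∧ wordRatio g p ≤ r) List.length ⟨w, List.prefix_rfl, hw⟩
  refine ⟨p, hpw, hpr, fun q hqp hqr => ?_⟩
  exact hqp.eq_of_length_le (hmin ⟨hqp.trans hpw, hqr⟩ hqp.length_le)

namespace IsCutWord

variable {g} {r : ℝ} {u w : List ι}

theorem eq_of_prefix (hu : IsCutWord g r u) (hw : IsCutWord g r w) (h : u <+: w) : u = w :=
  hw.2 u h hu.1

theorem cons (hw : IsCutWord g r w) (hr : r ≤ 1) (i : ι) :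
    IsCutWord g ((g i).ratio * r) (i :: w) := by
  have hi := (g i).ratio_pos
  refine ⟨by rw [wordRatio_cons]; gcongr; exact hw.1, ?_⟩
  rintro (_ | ⟨j, p⟩) hp hpr
  · have : (g i).ratio * r < 1 := (mul_le_of_le_one_right hi.le hr).trans_lt (g i).ratio_lt_one
    exact absurd hpr this.not_ge
  · obtain ⟨rfl, hpw⟩ := List.cons_prefix_cons.1 hp
    rw [wordRatio_cons] at hpr
    rw [hw.2 p hpw (le_of_mul_le_mul_left hpr hi)]

theorem map {g : κ → ContractingSimilitude d} {f : ι → κ} (hw : IsCutWord (g ∘ f) r w) :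
    IsCutWord g r (w.map f) := by
  refine ⟨(wordRatio_map g f w).trans_le hw.1, fun p hp hpr => ?_⟩
  obtain ⟨q, hq, rfl⟩ := List.prefix_map_iff.1 hp
  rw [hw.2 q hq (wordRatio_map g f q ▸ hpr)]

theorem mul_le_wordRatio (hw : IsCutWord g r w) (hr : r ≤ 1) {c : ℝ} (hc0 : 0 ≤ c) (hc1 : c ≤ 1)
    (hc : ∀ i, c ≤ (g i).ratio) : c * r ≤ wordRatio g w := by
  rcases w.eq_nil_or_concat' with rfl | ⟨p, i, rfl⟩
  · exact (mul_le_of_le_one_right hc0 hr).trans hc1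
  · have hp : r < wordRatio g p := by
      by_contra! h
      simpa using hw.2 p (List.prefix_append _ _) h
    rw [wordRatio_append, wordRatio_cons, wordRatio_nil, mul_one, mul_comm]
    exact mul_le_mul hp.le (hc i) hc0 (wordRatio_pos g p).le

end IsCutWord

end Words

section OpenSetCondition

variable {d N : ℕ} {S : IFS d N}

theorem IFS.OpenSetCondition.exists_encard_nearCutWords_le (hS : S.OpenSetCondition)
    {K : Set (EuclideanSpace ℝ (Fin d))} (hK : Bornology.IsBounded K) :
    ∃ C : ℕ, ∀ X r, 0 < r → r ≤ 1 → (nearCutWords S K X r).encard ≤ C := by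
  obtain ⟨U, hUo, ⟨z, hz⟩, hU, hd⟩ := hS
  have hmaps : ∀ i, MapsTo (S i) U U := fun i =>
    mapsTo_iff_image_subset.2 (iUnion_subset_iff.1 hU i)
  obtain ⟨ρ, hρ, hball⟩ := Metric.isOpen_iff.1 hUo z hz
  obtain ⟨D, hD⟩ := hK.subset_closedBall z
  obtain ⟨c, hc0, hc1, hc⟩ := exists_pos_forall_le_ratio S
  obtain ⟨C, hC⟩ := exists_encard_le_of_pairwise_le_dist (EuclideanSpace ℝ (Fin d)) (D + 1)
    (mul_pos hc0 hρ)
  refine ⟨C, fun X r hr hr1 => ?_⟩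
  have separated : ∀ w ∈ nearCutWords S K X r, ∀ w' ∈ nearCutWords S K X r, w ≠ w' →
      r * (c * ρ) ≤ dist (wordMap S w z) (wordMap S w' z) := by
    rintro w ⟨hw, -⟩ w' ⟨hw', -⟩ hne
    calc r * (c * ρ) = c * r * ρ := by ring
      _ ≤ wordRatio S w * ρ := by gcongr; exact hw.mul_le_wordRatio hr1 hc0.le hc1 hc
      _ ≤ _ := wordRatio_mul_le_dist S hmaps hd (fun h => hne (hw.eq_of_prefix hw' h))
        (fun h => hne (hw'.eq_of_prefix hw h).symm) hz hball
  have inj : InjOn (fun w => wordMap S w z) (nearCutWords S K X r) := by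
    intro w hw w' hw' heq
    by_contra hne
    have := separated w hw w' hw' hne
    rw [show wordMap S w z = wordMap S w' z from heq, dist_self] at this
    exact this.not_gt (by positivity)
  rw [← inj.encard_image]
  refine hC X hr _ ?_ (inj.pairwise_image.2 separated)
  rintro _ ⟨w, ⟨hw, _, ⟨x, hx, rfl⟩, hxX⟩, rfl⟩
  calc dist (wordMap S w z) X
      ≤ dist (wordMap S w x) (wordMap S w z) + dist (wordMap S w x) X := dist_triangle_left _ _ _
    _ ≤ r * D + r := by
        rw [dist_wordMap]
        gcongr
        exacts [hw.1, hD hx, hxX]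
    _ = r * (D + 1) := by ring

end OpenSetCondition

/-! ### Hutchinson's theorem -/

section Bernoulli

variable {d : ℕ} {ι : Type*} (g : ι → ContractingSimilitude d)

theorem exists_sum_ratio_rpow_eq_one [Fintype ι] [Nonempty ι] :
    ∃ s : ℝ≥0, ∑ i, (g i).ratio ^ (s : ℝ) = 1 := by
  have continuous_sum : Continuous fun t : ℝ => ∑ i, (g i).ratio ^ t :=
    continuous_finsetSum _ fun i _ => Real.continuous_const_rpow (g i).ratio_pos.ne'
  have tendsto_zero : Tendsto (fun t : ℝ => ∑ i, (g i).ratio ^ t) atTop (𝓝 0) := by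
    simpa using tendsto_finsetSum (Finset.univ : Finset ι) fun i _ =>
      tendsto_rpow_atTop_of_base_lt_one (g i).ratio (by linarith [(g i).ratio_pos])
        (g i).ratio_lt_one
  obtain ⟨T, hT, hsum⟩ :=
    ((eventually_ge_atTop 0).and (tendsto_zero.eventually_le_const one_pos)).exists
  have one_le : (1 : ℝ) ≤ ∑ i, (g i).ratio ^ (0 : ℝ) := by
    simp [Nat.one_le_iff_ne_zero]
  obtain ⟨s, hs, hs1⟩ := intermediate_value_Icc' hT continuous_sum.continuousOn ⟨hsum, one_le⟩
  exact ⟨⟨s, hs.1⟩, hs1⟩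

theorem ofReal_wordRatio_rpow (s : ℝ) (w : List ι) :
    ENNReal.ofReal (wordRatio g w) ^ s =
      (w.map fun i => ENNReal.ofReal ((g i).ratio ^ s)).prod := by
  induction w with
  | nil => simp
  | cons i w ih =>
    rw [wordRatio_cons, ENNReal.ofReal_mul (g i).ratio_pos.le, ENNReal.mul_rpow_of_ne_top
      ENNReal.ofReal_ne_top ENNReal.ofReal_ne_top, ih, List.map_cons, List.prod_cons,
      ENNReal.ofReal_rpow_of_pos (g i).ratio_pos]

theorem sum_ofReal_ratio_rpow [Fintype ι] {s : ℝ} (hs : ∑ i, (g i).ratio ^ s = 1) :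
    ∑ i, ENNReal.ofReal ((g i).ratio ^ s) = 1 := by
  rw [← ENNReal.ofReal_sum_of_nonneg fun i _ => Real.rpow_nonneg (g i).ratio_pos.le s, hs,
    ENNReal.ofReal_one]

theorem sum_ediam_wordMap_image_rpow_le [Fintype ι] {s : ℝ} (hs0 : 0 ≤ s)
    (hs : ∑ i, (g i).ratio ^ s = 1) (A : Set (EuclideanSpace ℝ (Fin d))) (n : ℕ) :
    ∑ x : Fin n → ι, ediam (wordMap g (List.ofFn x) '' A) ^ s ≤ ediam A ^ s := by
  have ediam_le : ∀ x : Fin n → ι, ediam (wordMap g (List.ofFn x) '' A) ^ s ≤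
      (∏ k, ENNReal.ofReal ((g (x k)).ratio ^ s)) * ediam A ^ s := by
    intro x
    calc ediam (wordMap g (List.ofFn x) '' A) ^ s
        ≤ (ENNReal.ofReal (wordRatio g (List.ofFn x)) * ediam A) ^ s := by
          gcongr
          exact (lipschitzWith_wordMap g _).ediam_image_le A
      _ = (∏ k, ENNReal.ofReal ((g (x k)).ratio ^ s)) * ediam A ^ s := by
          rw [ENNReal.mul_rpow_of_nonneg _ _ hs0, ofReal_wordRatio_rpow, List.map_ofFn,
            List.prod_ofFn]
          rfl
  refine (Finset.sum_le_sum fun x _ => ediam_le x).trans_eq ?_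
  rw [← Finset.sum_mul, ← Fintype.sum_pow (fun i => ENNReal.ofReal ((g i).ratio ^ s)),
    sum_ofReal_ratio_rpow g hs, one_pow, one_mul]

theorem exists_measure_map_range_eq_le [Fintype ι] [MeasurableSpace ι]
    [MeasurableSingletonClass ι] {s : ℝ} (hs : ∑ i, (g i).ratio ^ s = 1) :
    ∃ μ : Measure (ℕ → ι), IsProbabilityMeasure μ ∧ ∀ w,
      μ {x | (List.range w.length).map x = w} ≤ ENNReal.ofReal (wordRatio g w) ^ s := by
  let ν : Measure ι := (PMF.ofFintype _ (sum_ofReal_ratio_rpow g hs)).toMeasure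
  have ν_singleton : ∀ i, ν {i} = ENNReal.ofReal ((g i).ratio ^ s) := fun i =>
    PMF.toMeasure_apply_singleton _ i (measurableSet_singleton i)
  refine ⟨Measure.infinitePi fun _ => ν, inferInstance, fun w => ?_⟩
  rcases eq_empty_or_nonempty {x : ℕ → ι | (List.range w.length).map x = w} with h | ⟨x, hx⟩
  · simp [h]
  rw [mem_ofPred_eq] at hx
  generalize w.length = n at hx ⊢
  subst hx
  have cylinder_eq : {y : ℕ → ι | (List.range n).map y = (List.range n).map x} =
      Set.pi (Finset.range n) fun k => {x k} := by
    ext y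
    simp [List.map_inj_left]
  rw [cylinder_eq, Measure.infinitePi_pi _ fun _ _ => measurableSet_singleton _,
    ofReal_wordRatio_rpow, List.map_map, ← List.prod_toFinset _ List.nodup_range,
    List.toFinset_range]
  simp only [ν_singleton, Function.comp_apply, le_refl]

theorem measure_preimage_closedBall_le [Finite ι] [MeasurableSpace ι]
    {K : Set (EuclideanSpace ℝ (Fin d))} {π : (ℕ → ι) → EuclideanSpace ℝ (Fin d)}
    (hπ : ∀ x n, π x ∈ wordMap g ((List.range n).map x) '' K) {s : ℝ} (hs0 : 0 ≤ s)
    {μ : Measure (ℕ → ι)}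
    (hμ : ∀ w, μ {x | (List.range w.length).map x = w} ≤ ENNReal.ofReal (wordRatio g w) ^ s)
    {X : EuclideanSpace ℝ (Fin d)} {r : ℝ} (hr : 0 < r) {C : ℕ}
    (hC : (nearCutWords g K X r).encard ≤ C) :
    μ (π ⁻¹' closedBall X r) ≤ C * ENNReal.ofReal r ^ s := by
  obtain ⟨c, hc0, hc1, hc⟩ := exists_lt_one_forall_ratio_le g
  have finite : (nearCutWords g K X r).Finite :=
    encard_lt_top_iff.1 (hC.trans_lt (ENat.natCast_lt_top C))
  have cover : π ⁻¹' closedBall X r ⊆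
      ⋃ w ∈ finite.toFinset, {x | (List.range w.length).map x = w} := by
    intro x hx
    obtain ⟨n, hn⟩ := exists_pow_lt_of_lt_one hr hc1
    obtain ⟨p, hp, hcut⟩ := exists_isCutWord_prefix g (w := (List.range n).map x) (r := r)
      ((wordRatio_le_pow g hc0 hc _).trans (by simpa using hn.le))
    have hpx : (List.range p.length).map x = p := by
      have hle : p.length ≤ n := by simpa using hp.length_le
      rw [List.prefix_iff_eq_take.1 hp]
      simp [← List.map_take, List.take_range, hle]
    exact mem_iUnion₂.2 ⟨p, finite.mem_toFinset.2 ⟨hcut, π x, hpx ▸ hπ x p.length, hx⟩, hpx⟩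
  have measure_le : ∀ w ∈ finite.toFinset,
      μ {x | (List.range w.length).map x = w} ≤ ENNReal.ofReal r ^ s := fun w hw =>
    (hμ w).trans (by gcongr; exact (finite.mem_toFinset.1 hw).1.1)
  calc μ (π ⁻¹' closedBall X r)
      ≤ ∑ w ∈ finite.toFinset, μ {x | (List.range w.length).map x = w} :=
        (measure_mono cover).trans (measure_biUnion_finset_le _ _)
    _ ≤ finite.toFinset.card * ENNReal.ofReal r ^ s := by
        simpa using Finset.sum_le_card_nsmul _ _ _ measure_le
    _ ≤ C * ENNReal.ofReal r ^ s := by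
        gcongr
        rwa [finite.encard_eq_coe_toFinset_card, Nat.cast_le] at hC

end Bernoulli

namespace IFS.IsInvariantSet

variable {d N : ℕ} {S : IFS d N} {K : Set (EuclideanSpace ℝ (Fin d))}

theorem mapsTo (hK : S.IsInvariantSet K) (i : Fin N) : MapsTo (S i) K K := fun x hx => by
  rw [hK.2.2]
  exact mem_iUnion.2 ⟨i, x, hx, rfl⟩

theorem exists_preimage (hK : S.IsInvariantSet K) {y : EuclideanSpace ℝ (Fin d)} (hy : y ∈ K) :
    ∃ i, ∃ x ∈ K, S i x = y := by
  rw [hK.2.2] at hy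
  exact mem_iUnion.1 hy

theorem subset_iUnion_wordMap_image (hK : S.IsInvariantSet K) (n : ℕ) :
    K ⊆ ⋃ x : Fin n → Fin N, wordMap S (List.ofFn x) '' K := by
  induction n with
  | zero => exact fun y hy => mem_iUnion.2 ⟨Fin.elim0, y, hy, rfl⟩
  | succ n ih =>
    intro y hy
    obtain ⟨i, z, hz, rfl⟩ := hK.exists_preimage hy
    obtain ⟨x, y, hyK, rfl⟩ := mem_iUnion.1 (ih hz)
    refine mem_iUnion.2 ⟨Fin.cons i x, y, hyK, ?_⟩
    rw [List.ofFn_cons]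
    rfl

theorem hausdorffMeasure_lt_top (hK : S.IsInvariantSet K) {s : ℝ} (hs0 : 0 ≤ s)
    (hs : ∑ i, (S i).ratio ^ s = 1) : μH[s] K < ⊤ := by
  have ediam_ne_top : ediam K ≠ ⊤ := hK.2.1.isBounded.ediam_ne_top
  obtain ⟨c, hc0, hc1, hc⟩ := exists_lt_one_forall_ratio_le S
  have tendsto_zero : Tendsto (fun n => ENNReal.ofReal (c ^ n) * ediam K) atTop (𝓝 0) := by
    simpa using ENNReal.Tendsto.mul_const (ENNReal.tendsto_ofReal
      (tendsto_pow_atTop_nhds_zero_of_lt_one hc0 hc1)) (Or.inr ediam_ne_top)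
  have ediam_le : ∀ n (x : Fin n → Fin N),
      ediam (wordMap S (List.ofFn x) '' K) ≤ ENNReal.ofReal (c ^ n) * ediam K := fun n x => by
    refine ((lipschitzWith_wordMap S _).ediam_image_le K).trans ?_
    gcongr
    exact ENNReal.ofReal_le_ofReal (by simpa using wordRatio_le_pow S hc0 hc (List.ofFn x))
  calc μH[s] K
      ≤ liminf (fun n => ∑ x : Fin n → Fin N, ediam (wordMap S (List.ofFn x) '' K) ^ s) atTop :=
        Measure.hausdorffMeasure_le_liminf_sum s K _ tendsto_zero
          (fun n (x : Fin n → Fin N) => wordMap S (List.ofFn x) '' K)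
          (Eventually.of_forall ediam_le) (Eventually.of_forall hK.subset_iUnion_wordMap_image)
    _ ≤ liminf (fun _ => ediam K ^ s) atTop :=
        liminf_le_liminf (Eventually.of_forall (sum_ediam_wordMap_image_rpow_le S hs0 hs K))
    _ = ediam K ^ s := liminf_const _
    _ < ⊤ := ENNReal.rpow_lt_top_of_nonneg hs0 ediam_ne_top

theorem exists_codeMap (hK : S.IsInvariantSet K) :
    ∃ π : (ℕ → Fin N) → EuclideanSpace ℝ (Fin d),
      ∀ x n, π x ∈ wordMap S ((List.range n).map x) '' K := by
  suffices ∀ x : ℕ → Fin N, (⋂ n, wordMap S ((List.range n).map x) '' K).Nonempty by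
    choose π hπ using this
    exact ⟨π, fun x => mem_iInter.1 (hπ x)⟩
  intro x
  have isCompact : ∀ n, IsCompact (wordMap S ((List.range n).map x) '' K) := fun n =>
    hK.2.1.image (lipschitzWith_wordMap S _).continuous
  refine IsCompact.nonempty_iInter_of_sequence_nonempty_isCompact_isClosed _ (fun n => ?_)
    (fun n => hK.1.image _) (isCompact 0) fun n => (isCompact n).isClosed
  rw [List.range_succ, List.map_append, wordMap_append, image_comp]
  exact image_mono (hK.mapsTo (x n)).image_subset

theorem hausdorffMeasure_pos (hK : S.IsInvariantSet K) (hS : S.OpenSetCondition) {s : ℝ}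
    (hs0 : 0 ≤ s) (hs : ∑ i, (S i).ratio ^ s = 1) : 0 < μH[s] K := by
  obtain ⟨π, hπ⟩ := hK.exists_codeMap
  obtain ⟨C, hC⟩ := hS.exists_encard_nearCutWords_le hK.2.1.isBounded
  obtain ⟨μ, _, hμ⟩ := exists_measure_map_range_eq_le S hs
  have preimage_eq : π ⁻¹' K = univ := eq_univ_of_forall fun x => by
    simpa [wordMap] using hπ x 0
  have bound := le_mul_hausdorffMeasure_of_closedBall_le (OuterMeasure.map π μ.toOuterMeasure)
    (C := C + 1) (by simp) (by finiteness) (s := s)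
    (fun X r hr hr1 => (measure_preimage_closedBall_le S hπ hs0 hμ hr (hC X r hr hr1)).trans
      (by gcongr; exact le_self_add)) K
  rw [OuterMeasure.map_apply, preimage_eq, Measure.toOuterMeasure_apply, measure_univ] at bound
  exact pos_of_mul_pos_right (one_pos.trans_le bound) zero_le

theorem exists_dimH_eq_and_hausdorffMeasure_pos_lt_top (hK : S.IsInvariantSet K)
    (hS : S.OpenSetCondition) : ∃ s : ℝ≥0, dimH K = s ∧ 0 < μH[s] K ∧ μH[s] K < ⊤ := by
  obtain ⟨y, hy⟩ := hK.1
  have : Nonempty (Fin N) := ⟨(hK.exists_preimage hy).choose⟩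
  obtain ⟨s, hs⟩ := exists_sum_ratio_rpow_eq_one S
  have pos := hK.hausdorffMeasure_pos hS s.2 hs
  have lt_top := hK.hausdorffMeasure_lt_top s.2 hs
  exact ⟨s, dimH_of_hausdorffMeasure_ne_zero_ne_top pos.ne' lt_top.ne, pos, lt_top⟩

end IFS.IsInvariantSet

/-! ### Neighbouring cylinders of a GIFS -/

/-- The action of a similitude on balls, which are coded by their centre and radius. -/
def ContractingSimilitude.mapBall {d : ℕ} (f : ContractingSimilitude d)
    (p : EuclideanSpace ℝ (Fin d) × ℝ) : EuclideanSpace ℝ (Fin d) × ℝ :=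
  (f p.1, f.ratio * p.2)

theorem ContractingSimilitude.mapsTo_ball_mapBall {d : ℕ} (f : ContractingSimilitude d)
    (p : EuclideanSpace ℝ (Fin d) × ℝ) :
    MapsTo f (ball p.1 (p.2 / 2)) (ball (f.mapBall p).1 ((f.mapBall p).2 / 2)) := fun z hz => by
  rw [mapBall, mem_ball, f.dist_map, mul_div_assoc]
  exact mul_lt_mul_of_pos_left hz f.ratio_pos

namespace GIFS

variable {d : ℕ} {V : Type*} {G : GIFS d V} {E : V → Set (EuclideanSpace ℝ (Fin d))}

/-- `G.IsPath u w v` says that the edges of the list `w` form a path from the state `u` to the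
state `v`. -/
def IsPath (G : GIFS d V) : V → List G.Edge → V → Prop
  | u, [], v => u = v
  | u, e :: w, v => G.src e = u ∧ IsPath G (G.tgt e) w v

/-- Some edge of `G` leads from the state `u` to the state `v`. -/
def Adj (G : GIFS d V) (u v : V) : Prop :=
  ∃ e, G.src e = u ∧ G.tgt e = v

/-- The paths from `u` that are cut words at scale `r` and whose cylinder in `E u` meets the closed
ball of radius `r` around `X`. -/
def nearPaths (E : V → Set (EuclideanSpace ℝ (Fin d))) (u : V) (X : EuclideanSpace ℝ (Fin d))
    (r : ℝ) : Set (List G.Edge) :=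
  {w | ∃ v, G.IsPath u w v ∧ IsCutWord G.map r w ∧
    (wordMap G.map w '' E v ∩ closedBall X r).Nonempty}

/-- The balls `(g_w (x v), ratio of g_w)`, one for each path `w` from `u` to some state `v`: they
mark the position and the size of the cylinders in the state `u`. -/
def cylinderBalls (G : GIFS d V) (x : V → EuclideanSpace ℝ (Fin d)) (u : V) :
    Set (EuclideanSpace ℝ (Fin d) × ℝ) :=
  {p | ∃ w v, G.IsPath u w v ∧ p = (wordMap G.map w (x v), wordRatio G.map w)}

/-- The largest number of cylinders in the state `u` that have the same scale as a given one and
come close to it. -/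
noncomputable def neighborNumber (G : GIFS d V) (E : V → Set (EuclideanSpace ℝ (Fin d)))
    (x : V → EuclideanSpace ℝ (Fin d)) (u : V) : ℕ∞ :=
  ⨆ p : G.cylinderBalls x u, (nearPaths (G := G) E u p.1.1 p.1.2).encard

/-- The balls of the cylinders whose number of neighbours is the largest possible one. -/
def maximalBalls (G : GIFS d V) (E : V → Set (EuclideanSpace ℝ (Fin d)))
    (x : V → EuclideanSpace ℝ (Fin d)) (u : V) : Set (EuclideanSpace ℝ (Fin d) × ℝ) :=
  {p ∈ G.cylinderBalls x u | (nearPaths (G := G) E u p.1 p.2).encard = G.neighborNumber E x u}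

theorem isPath_append {u v : V} {p q : List G.Edge} :
    G.IsPath u (p ++ q) v ↔ ∃ z, G.IsPath u p z ∧ G.IsPath z q v := by
  induction p generalizing u with
  | nil => simp [IsPath]
  | cons e p ih => simp [IsPath, ih, and_assoc]

namespace IsInvariantFamily

theorem mapsTo (hE : G.IsInvariantFamily E) (e : G.Edge) :
    MapsTo (G.map e) (E (G.tgt e)) (E (G.src e)) := fun x hx => by
  rw [hE.2]
  exact mem_iUnion₂.2 ⟨e, rfl, x, hx, rfl⟩

theorem exists_edge (hE : G.IsInvariantFamily E) {u : V} {x : EuclideanSpace ℝ (Fin d)}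
    (hx : x ∈ E u) : ∃ e, G.src e = u ∧ x ∈ G.map e '' E (G.tgt e) := by
  rw [hE.2] at hx
  simpa only [mem_iUnion₂, exists_prop] using hx

theorem mapsTo_wordMap (hE : G.IsInvariantFamily E) {u v : V} {w : List G.Edge}
    (hw : G.IsPath u w v) : MapsTo (wordMap G.map w) (E v) (E u) := by
  induction w generalizing u with
  | nil => exact hw ▸ mapsTo_id (E u)
  | cons e w ih =>
    obtain ⟨rfl, hw⟩ := hw
    exact (hE.mapsTo e).comp (ih hw)

theorem hausdorffMeasure_pos_of_reflTransGen (hE : G.IsInvariantFamily E) {s : ℝ} (hs : 0 ≤ s)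
    {u v : V} (huv : Relation.ReflTransGen G.Adj u v) (hv : 0 < μH[s] (E v)) :
    0 < μH[s] (E u) := by
  induction huv using Relation.ReflTransGen.head_induction_on with
  | refl => exact hv
  | head hadj _ ih =>
    obtain ⟨e, rfl, rfl⟩ := hadj
    have bound : μH[s] (E (G.tgt e)) ≤
        ((G.map e).ratio⁻¹.toNNReal : ℝ≥0∞) ^ s * μH[s] (E (G.src e)) :=
      ((G.map e).antilipschitzWith.le_hausdorffMeasure_image hs _).trans
        (by gcongr; exact (hE.mapsTo e).image_subset)
    exact pos_of_mul_pos_right (ih.trans_le bound) zero_le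

end IsInvariantFamily

section Neighbors

variable {x : V → EuclideanSpace ℝ (Fin d)}

theorem mk_one_mem_cylinderBalls (u : V) : (x u, (1 : ℝ)) ∈ G.cylinderBalls x u :=
  ⟨[], u, rfl, rfl⟩

theorem pos_and_le_one_of_mem_cylinderBalls {u : V} {p : EuclideanSpace ℝ (Fin d) × ℝ}
    (hp : p ∈ G.cylinderBalls x u) : 0 < p.2 ∧ p.2 ≤ 1 := by
  obtain ⟨w, v, -, rfl⟩ := hp
  exact ⟨wordRatio_pos _ w, wordRatio_le_one _ w⟩

theorem mapBall_mem_cylinderBalls {e : G.Edge} {p : EuclideanSpace ℝ (Fin d) × ℝ}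
    (hp : p ∈ G.cylinderBalls x (G.tgt e)) :
    (G.map e).mapBall p ∈ G.cylinderBalls x (G.src e) := by
  obtain ⟨w, v, hw, rfl⟩ := hp
  exact ⟨e :: w, v, ⟨rfl, hw⟩, by rw [wordRatio_cons]; rfl⟩

theorem cons_image_nearPaths_subset (e : G.Edge) {p : EuclideanSpace ℝ (Fin d) × ℝ}
    (hp : p.2 ≤ 1) :
    (e :: ·) '' nearPaths E (G.tgt e) p.1 p.2 ⊆
      nearPaths E (G.src e) ((G.map e).mapBall p).1 ((G.map e).mapBall p).2 := by
  rintro _ ⟨w, ⟨v, hw, hcut, _, ⟨y, hy, rfl⟩, hyp⟩, rfl⟩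
  refine ⟨v, ⟨rfl, hw⟩, hcut.cons hp e, wordMap G.map (e :: w) y, ⟨y, hy, rfl⟩, ?_⟩
  simp only [wordMap, Function.comp_apply, ContractingSimilitude.mapBall, mem_closedBall,
    (G.map e).dist_map]
  exact mul_le_mul_of_nonneg_left hyp (G.map e).ratio_pos.le

theorem encard_nearPaths_le_neighborNumber {u : V} {p : EuclideanSpace ℝ (Fin d) × ℝ}
    (hp : p ∈ G.cylinderBalls x u) :
    (nearPaths (G := G) E u p.1 p.2).encard ≤ G.neighborNumber E x u :=
  le_iSup (fun p : G.cylinderBalls x u => (nearPaths (G := G) E u p.1.1 p.1.2).encard) ⟨p, hp⟩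

theorem encard_nearPaths_le_mapBall (e : G.Edge) {p : EuclideanSpace ℝ (Fin d) × ℝ}
    (hp : p.2 ≤ 1) :
    (nearPaths (G := G) E (G.tgt e) p.1 p.2).encard ≤
      (nearPaths (G := G) E (G.src e) ((G.map e).mapBall p).1
        ((G.map e).mapBall p).2).encard := by
  rw [← (List.cons_injective (a := e)).encard_image]
  exact encard_le_encard (cons_image_nearPaths_subset e hp)

theorem neighborNumber_le_of_reflTransGen {u v : V} (huv : Relation.ReflTransGen G.Adj u v) :
    G.neighborNumber E x v ≤ G.neighborNumber E x u := by
  induction huv using Relation.ReflTransGen.head_induction_on with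
  | refl => exact le_rfl
  | head hadj _ ih =>
    obtain ⟨e, rfl, rfl⟩ := hadj
    refine ih.trans (iSup_le fun p => ?_)
    exact (encard_nearPaths_le_mapBall e (pos_and_le_one_of_mem_cylinderBalls p.2).2).trans
      (encard_nearPaths_le_neighborNumber (mapBall_mem_cylinderBalls p.2))

theorem maximalBalls_nonempty {u : V} (hu : G.neighborNumber E x u ≠ ⊤) :
    (G.maximalBalls E x u).Nonempty := by
  have : Nonempty (G.cylinderBalls x u) := ⟨⟨_, mk_one_mem_cylinderBalls u⟩⟩
  obtain ⟨p, hp⟩ := ENat.exists_eq_iSup_of_lt_top (lt_top_iff_ne_top.2 hu)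
  exact ⟨p.1, p.2, hp⟩

variable {e : G.Edge} {p q : EuclideanSpace ℝ (Fin d) × ℝ}

theorem mapBall_mem_maximalBalls (he : Relation.ReflTransGen G.Adj (G.tgt e) (G.src e))
    (hp : p ∈ G.maximalBalls E x (G.tgt e)) :
    (G.map e).mapBall p ∈ G.maximalBalls E x (G.src e) := by
  have hmem := mapBall_mem_cylinderBalls hp.1
  refine ⟨hmem, (encard_nearPaths_le_neighborNumber hmem).antisymm ?_⟩
  calc G.neighborNumber E x (G.src e) ≤ G.neighborNumber E x (G.tgt e) :=
        neighborNumber_le_of_reflTransGen he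
    _ = (nearPaths E (G.tgt e) p.1 p.2).encard := hp.2.symm
    _ ≤ _ := encard_nearPaths_le_mapBall e (pos_and_le_one_of_mem_cylinderBalls hp.1).2

/-- By maximality, there is no room for further neighbours in the image of a maximal cylinder. -/
theorem nearPaths_mapBall_eq (he : Relation.ReflTransGen G.Adj (G.tgt e) (G.src e))
    (hfin : G.neighborNumber E x (G.src e) ≠ ⊤) (hp : p ∈ G.maximalBalls E x (G.tgt e)) :
    nearPaths E (G.src e) ((G.map e).mapBall p).1 ((G.map e).mapBall p).2 =
      (e :: ·) '' nearPaths E (G.tgt e) p.1 p.2 := by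
  have hmax := (mapBall_mem_maximalBalls he hp).2
  refine (Set.Finite.eq_of_subset_of_encard_le' ?_
    (cons_image_nearPaths_subset e (pos_and_le_one_of_mem_cylinderBalls hp.1).2) ?_).symm
  · exact encard_ne_top_iff.1 (hmax.trans_ne hfin)
  · rw [hmax, (List.cons_injective (a := e)).encard_image, hp.2]
    exact neighborNumber_le_of_reflTransGen he

/-- Otherwise a prefix of the path of `q` would be a near path of the image of `p` that does not
start with `e`. -/
theorem lt_dist_mapBall_of_ne (hE : G.IsInvariantFamily E) (hx : ∀ u, x u ∈ E u)
    (he : Relation.ReflTransGen G.Adj (G.tgt e) (G.src e))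
    (hfin : G.neighborNumber E x (G.src e) ≠ ⊤) (hp : p ∈ G.maximalBalls E x (G.tgt e))
    {f : G.Edge} (hne : e ≠ f) (hsrc : G.src e = G.src f)
    (hq : q ∈ G.cylinderBalls x (G.tgt f))
    (hle : ((G.map f).mapBall q).2 ≤ ((G.map e).mapBall p).2) :
    ((G.map e).mapBall p).2 < dist ((G.map f).mapBall q).1 ((G.map e).mapBall p).1 := by
  obtain ⟨w, v, hw, rfl⟩ := hq
  by_contra! hdist
  obtain ⟨l, ⟨t, ht⟩, hcut⟩ := exists_isCutWord_prefix G.map (w := f :: w)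
    ((wordRatio_cons _ _ _).trans_le hle)
  obtain ⟨z, hl, htz⟩ := isPath_append.1 (show G.IsPath (G.src e) (l ++ t) v from
    ht ▸ ⟨hsrc.symm, hw⟩)
  have near : l ∈ nearPaths E (G.src e) ((G.map e).mapBall p).1 ((G.map e).mapBall p).2 := by
    refine ⟨z, hl, hcut, _, ⟨_, hE.mapsTo_wordMap htz (hx v), rfl⟩, ?_⟩
    rwa [← Function.comp_apply (f := wordMap G.map l), ← wordMap_append, ht]
  rw [nearPaths_mapBall_eq he hfin hp] at near
  obtain ⟨l, -, rfl⟩ := near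
  exact hne (List.cons.inj ht).1

theorem disjoint_image_ball_of_ne (hE : G.IsInvariantFamily E) (hx : ∀ u, x u ∈ E u)
    (hreach : ∀ e, Relation.ReflTransGen G.Adj (G.tgt e) (G.src e))
    (hfin : ∀ u, G.neighborNumber E x u ≠ ⊤) {f : G.Edge} (hne : e ≠ f) (hsrc : G.src e = G.src f)
    (hp : p ∈ G.maximalBalls E x (G.tgt e)) (hq : q ∈ G.maximalBalls E x (G.tgt f)) :
    Disjoint (G.map e '' ball p.1 (p.2 / 2)) (G.map f '' ball q.1 (q.2 / 2)) := by
  refine (ball_disjoint_ball ?_).mono ((G.map e).mapsTo_ball_mapBall p).image_subset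
    ((G.map f).mapsTo_ball_mapBall q).image_subset
  rcases le_total ((G.map f).mapBall q).2 ((G.map e).mapBall p).2 with hle | hle
  · rw [dist_comm]
    linarith [lt_dist_mapBall_of_ne hE hx (hreach e) (hfin _) hp hne hsrc hq.1 hle]
  · linarith [lt_dist_mapBall_of_ne hE hx (hreach f) (hfin _) hq hne.symm hsrc.symm hp.1 hle]

end Neighbors

theorem IsInvariantFamily.openSetCondition (hE : G.IsInvariantFamily E)
    (hreach : ∀ e, Relation.ReflTransGen G.Adj (G.tgt e) (G.src e)) {C : ℕ}
    (hC : ∀ u X r, 0 < r → r ≤ 1 → (nearPaths (G := G) E u X r).encard ≤ C) :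
    G.OpenSetCondition := by
  choose x hx using fun u => (hE.1 u).1
  have hfin : ∀ u, G.neighborNumber E x u ≠ ⊤ := fun u => by
    refine ((iSup_le fun p => ?_).trans_lt (ENat.natCast_lt_top C)).ne
    obtain ⟨hpos, hle⟩ := pos_and_le_one_of_mem_cylinderBalls p.2
    exact hC u _ _ hpos hle
  refine ⟨fun u => ⋃ p ∈ G.maximalBalls E x u, ball p.1 (p.2 / 2),
    fun u => ⟨isOpen_biUnion fun _ _ => isOpen_ball, ?_⟩, fun e => ?_, fun e f hne hsrc => ?_⟩
  · obtain ⟨p, hp⟩ := maximalBalls_nonempty (hfin u)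
    have hpos := (pos_and_le_one_of_mem_cylinderBalls hp.1).1
    exact ⟨p.1, mem_iUnion₂.2 ⟨p, hp, mem_ball_self (half_pos hpos)⟩⟩
  · rintro _ ⟨z, hz, rfl⟩
    obtain ⟨p, hp, hzp⟩ := mem_iUnion₂.1 hz
    exact mem_iUnion₂.2 ⟨_, mapBall_mem_maximalBalls (hreach e) hp,
      (G.map e).mapsTo_ball_mapBall p hzp⟩
  · simp only [image_iUnion₂, disjoint_iUnion_left, disjoint_iUnion_right]
    exact fun p hp q hq => disjoint_image_ball_of_ne hE hx hreach hfin hne hsrc hq hp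

end GIFS

/-! ### GIFSs over an IFS -/

theorem exists_lt_one_forall_lipschitzWith {d : ℕ} {ι : Type*} [Finite ι]
    (g : ι → ContractingSimilitude d) : ∃ c : ℝ≥0, c < 1 ∧ ∀ i, LipschitzWith c (g i) := by
  obtain ⟨c, -, hc1, hc⟩ := exists_lt_one_forall_ratio_le g
  exact ⟨c.toNNReal, Real.toNNReal_lt_one.2 hc1, fun i =>
    (g i).lipschitzWith.weaken (Real.toNNReal_mono (hc i))⟩

theorem IFS.IsInvariantSet.subset_of_mapsTo {d N : ℕ} {S : IFS d N}
    {K F : Set (EuclideanSpace ℝ (Fin d))} (hK : S.IsInvariantSet K) (hFne : F.Nonempty)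
    (hF : IsClosed F) (h : ∀ i, MapsTo (S i) F F) : K ⊆ F := by
  obtain ⟨c, hc1, hc⟩ := exists_lt_one_forall_lipschitzWith S
  refine subset_of_forall_exists_lipschitzWith (V := Unit) hc1 (E := fun _ => K) (F := fun _ => F)
    (fun _ => hK.2.1.isBounded) (fun _ => hFne) (fun _ => hF) (fun _ x hx => ?_) ()
  obtain ⟨i, y, hy, rfl⟩ := hK.exists_preimage hx
  exact ⟨(), S i, hc i, mem_image_of_mem _ hy, h i⟩

theorem GIFS.IsInvariantFamily.subset_of_mapsTo {d : ℕ} {V : Type*} [Finite V] {G : GIFS d V}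
    {E F : V → Set (EuclideanSpace ℝ (Fin d))} (hE : G.IsInvariantFamily E)
    (hFne : ∀ u, (F u).Nonempty) (hF : ∀ u, IsClosed (F u))
    (h : ∀ e, MapsTo (G.map e) (F (G.tgt e)) (F (G.src e))) (u : V) : E u ⊆ F u := by
  have := G.edge_finite
  obtain ⟨c, hc1, hc⟩ := exists_lt_one_forall_lipschitzWith G.map
  refine subset_of_forall_exists_lipschitzWith hc1 (fun u => (hE.1 u).2.isBounded) hFne hF
    (fun u x hx => ?_) u
  obtain ⟨e, rfl, hxe⟩ := hE.exists_edge hx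
  exact ⟨_, _, hc e, hxe, h e⟩

namespace GIFS

/-- The GIFS `G` lifts the IFS `S` along the labels `ℓ` of its edges: its maps are those of `S`,
and for every state `v` each map of `S` is the label of exactly one edge that ends in `v`. -/
structure IsLift {d N : ℕ} {V : Type*} (G : GIFS d V) (S : IFS d N) (ℓ : G.Edge → Fin N) :
    Prop where
  map_eq : G.map = S ∘ ℓ
  bijective : Function.Bijective fun e => (ℓ e, G.tgt e)

namespace IsLift

variable {d N : ℕ} {V : Type*} {G : GIFS d V} {S : IFS d N} {ℓ : G.Edge → Fin N}
  {K : Set (EuclideanSpace ℝ (Fin d))} {E : V → Set (EuclideanSpace ℝ (Fin d))}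

theorem subset_invariantSet [Finite V] (hG : G.IsLift S ℓ) (hE : G.IsInvariantFamily E)
    (hK : S.IsInvariantSet K) (u : V) : E u ⊆ K :=
  hE.subset_of_mapsTo (fun _ => hK.1) (fun _ => hK.2.1.isClosed)
    (fun e => by rw [hG.map_eq]; exact hK.mapsTo (ℓ e)) u

theorem invariantSet_subset_iUnion [Finite V] [Nonempty V] (hG : G.IsLift S ℓ)
    (hE : G.IsInvariantFamily E) (hK : S.IsInvariantSet K) : K ⊆ ⋃ u, E u := by
  refine hK.subset_of_mapsTo (nonempty_iUnion.2 ⟨Classical.arbitrary V, (hE.1 _).1⟩)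
    (isClosed_iUnion_of_finite fun u => (hE.1 u).2.isClosed) fun i x hx => ?_
  obtain ⟨v, hv⟩ := mem_iUnion.1 hx
  obtain ⟨e, he⟩ := hG.bijective.surjective (i, v)
  obtain ⟨rfl, rfl⟩ := Prod.mk.inj he
  have hmem := hE.mapsTo e hv
  rw [hG.map_eq] at hmem
  exact mem_iUnion.2 ⟨_, hmem⟩

theorem exists_hausdorffMeasure_pos [Finite V] [Nonempty V] (hG : G.IsLift S ℓ)
    (hE : G.IsInvariantFamily E) (hK : S.IsInvariantSet K) {s : ℝ} (hs : 0 < μH[s] K) :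
    ∃ v, 0 < μH[s] (E v) := by
  by_contra! hnull
  exact hs.ne' (measure_mono_null (hG.invariantSet_subset_iUnion hE hK)
    (measure_iUnion_null fun v => nonpos_iff_eq_zero.1 (hnull v)))

theorem eq_of_isPath (hG : G.IsLift S ℓ) {u u' v : V} {w w' : List G.Edge}
    (hw : G.IsPath u w v) (hw' : G.IsPath u' w' v) (h : w.map ℓ = w'.map ℓ) :
    u = u' ∧ w = w' := by
  induction w generalizing u u' w' with
  | nil =>
    obtain rfl := List.map_eq_nil_iff.1 h.symm
    exact ⟨hw.trans hw'.symm, rfl⟩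
  | cons e w ih =>
    obtain ⟨e', w', rfl, label_eq, map_eq⟩ := List.map_eq_cons_iff.1 h.symm
    obtain ⟨rfl, hw⟩ := hw
    obtain ⟨rfl, hw'⟩ := hw'
    obtain ⟨tgt_eq, rfl⟩ := ih hw hw' map_eq.symm
    obtain rfl := hG.bijective.injective (Prod.ext label_eq.symm tgt_eq)
    exact ⟨rfl, rfl⟩

theorem encard_nearPaths_le [Fintype V] (hG : G.IsLift S ℓ) (hE : ∀ u, E u ⊆ K) (u : V)
    (X : EuclideanSpace ℝ (Fin d)) (r : ℝ) :
    (nearPaths (G := G) E u X r).encard ≤ Fintype.card V * (nearCutWords S K X r).encard := by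
  let nearPathsTo (v : V) : Set (List G.Edge) := {w ∈ nearPaths E u X r | G.IsPath u w v}
  have subset_iUnion : nearPaths E u X r ⊆ ⋃ v, nearPathsTo v := fun w hw =>
    mem_iUnion.2 ⟨hw.choose, hw, hw.choose_spec.1⟩
  have encard_le (v : V) : (nearPathsTo v).encard ≤ (nearCutWords S K X r).encard := by
    refine encard_le_encard_of_injOn (f := List.map ℓ) ?_
      fun w hw w' hw' h => (hG.eq_of_isPath hw.2 hw'.2 h).2
    rintro w ⟨⟨z, -, hcut, hnear⟩, -⟩
    rw [hG.map_eq] at hcut hnear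
    refine ⟨hcut.map, ?_⟩
    rw [wordMap_map]
    exact hnear.mono (inter_subset_inter_left _ (image_mono (hE z)))
  calc (nearPaths (G := G) E u X r).encard ≤ ∑ v, (nearPathsTo v).encard :=
        (encard_le_encard subset_iUnion).trans (encard_iUnion_le_of_fintype _)
    _ ≤ ∑ _v : V, (nearCutWords S K X r).encard := Finset.sum_le_sum fun v _ => encard_le v
    _ = _ := by rw [Finset.sum_const, Finset.card_univ, nsmul_eq_mul]

theorem openSetCondition [Finite V] (hG : G.IsLift S ℓ) (hE : G.IsInvariantFamily E)
    (hK : S.IsInvariantSet K) (hS : S.OpenSetCondition)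
    (hreach : ∀ e, Relation.ReflTransGen G.Adj (G.tgt e) (G.src e)) : G.OpenSetCondition := by
  have := Fintype.ofFinite V
  obtain ⟨C, hC⟩ := hS.exists_encard_nearCutWords_le hK.2.1.isBounded
  refine hE.openSetCondition hreach (C := Fintype.card V * C) fun u X r hr hr1 => ?_
  push_cast
  exact (hG.encard_nearPaths_le (hG.subset_invariantSet hE hK) u X r).trans
    (by gcongr; exact hC X r hr hr1)

end IsLift

end GIFS

/-! ### Induced GIFSs -/

/-- A substitution `σ` is irreducible if every letter appears in some iterate `σ^n(v)` of every
letter `v`. In contrast to primitivity, `n` may depend on the letters. -/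
def IsIrreducibleSubstitution {α : Type*} (σ : α → List α) : Prop :=
  ∀ u v : α, ∃ n : ℕ, u ∈ (fun w : List α => w.flatMap σ)^[n] [v]

theorem IsPrimitiveSubstitution.isIrreducibleSubstitution {α : Type*} {σ : α → List α}
    (hσ : IsPrimitiveSubstitution σ) : IsIrreducibleSubstitution σ :=
  let ⟨n, _, hn⟩ := hσ
  fun u v => ⟨n, hn u v⟩

section Induced

open Relation

variable {d N m : ℕ} {S : IFS d N} {Q : Fin m → List (CopyEdge N m)} {u v : OrientedEdge m}
  {e : CopyEdge N m} {β : Fin N → ℤˣ}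

theorem OrientedEdge.rev_rev (v : OrientedEdge m) : v.rev.rev = v := by
  simp [rev]

theorem mem_fineSubstitution :
    e ∈ fineSubstitution Q u ↔ (e.1, e.2.1, u.2 * e.2.2) ∈ Q u.1 := by
  obtain ⟨j, ε⟩ := u
  obtain ⟨i, k, δ⟩ := e
  rcases Int.units_eq_one_or ε with rfl | rfl
  · simp [fineSubstitution]
  · have : (-1 : ℤˣ) ≠ 1 := by decide
    simp only [fineSubstitution, this, if_false, reversePath, List.mem_reverse, List.mem_map,
      OrientedEdge.rev, neg_mul, one_mul, Prod.mk.injEq, Prod.exists]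
    constructor
    · rintro ⟨_, _, _, h, rfl, rfl, rfl⟩
      simpa using h
    · exact fun h => ⟨_, _, _, h, rfl, rfl, neg_neg δ⟩

theorem mem_fineSubstitution_rev :
    (e.1, e.2.rev) ∈ fineSubstitution Q u.rev ↔ e ∈ fineSubstitution Q u := by
  simp [mem_fineSubstitution, OrientedEdge.rev]

theorem nodup_fineSubstitution (hQ : (List.ofFn Q).flatten.Nodup) (u : OrientedEdge m) :
    (fineSubstitution Q u).Nodup := by
  have hnodup : (Q u.1).Nodup := (List.nodup_flatten.1 hQ).1 _ (List.mem_ofFn.2 ⟨u.1, rfl⟩)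
  have rev_injective : Function.Injective fun e : CopyEdge N m => (e.1, e.2.rev) :=
    Function.LeftInverse.injective (g := fun e => (e.1, e.2.rev)) fun e => by
      simp only [OrientedEdge.rev_rev]
  unfold fineSubstitution
  split_ifs
  · exact hnodup
  · exact List.nodup_reverse.2 (hnodup.map rev_injective)

/-- The sign of the state is determined by `e`, as `Q` only contains edges with the signs `β`. -/
theorem existsUnique_mem_fineSubstitution (hQ : (List.ofFn Q).flatten.Nodup)
    (hmem : ∀ e, e ∈ (List.ofFn Q).flatten ↔ e ∈ orientedGraph β) (e : CopyEdge N m) :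
    ∃! u, e ∈ fineSubstitution Q u := by
  have exists_mem_iff (e : CopyEdge N m) : (∃ j, e ∈ Q j) ↔ e.2.2 = β e.1 := by
    simpa [orientedGraph] using hmem e
  obtain ⟨j, hj⟩ := (exists_mem_iff (e.1, e.2.1, β e.1)).2 rfl
  refine ⟨(j, β e.1 * e.2.2), mem_fineSubstitution.2 ?_, ?_⟩
  · simpa [mul_assoc] using hj
  · rintro ⟨k, ε⟩ hk
    rw [mem_fineSubstitution] at hk
    have sign_eq : ε * e.2.2 = β e.1 := (exists_mem_iff _).1 ⟨k, hk⟩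
    obtain rfl : ε = β e.1 * e.2.2 := by rw [← sign_eq, mul_assoc, Int.units_mul_self, mul_one]
    rw [sign_eq] at hk
    have disjoint := List.pairwise_ofFn.1 (List.nodup_flatten.1 hQ).2
    rcases lt_trichotomy j k with h | rfl | h
    · exact absurd hk (disjoint h hj)
    · rfl
    · exact absurd hj (disjoint h hk)

/-- The index `i` of the similitude `S_i` that an edge of the induced GIFS carries. -/
def inducedLabel (S : IFS d N) (Q : Fin m → List (CopyEdge N m))
    (b : (inducedGIFS S Q).Edge) : Fin N :=
  ((fineSubstitution Q b.1).get b.2).1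

theorem inducedGIFS_isLift (hQ : (List.ofFn Q).flatten.Nodup)
    (hmem : ∀ e, e ∈ (List.ofFn Q).flatten ↔ e ∈ orientedGraph β) :
    (inducedGIFS S Q).IsLift S (inducedLabel S Q) where
  map_eq := rfl
  bijective :=
    bijective_sigma_get (nodup_fineSubstitution hQ) (existsUnique_mem_fineSubstitution hQ hmem)

theorem exists_edge_of_mem_fineSubstitution (S : IFS d N) (he : e ∈ fineSubstitution Q u) :
    ∃ b, (inducedGIFS S Q).src b = u ∧ (inducedGIFS S Q).tgt b = e.2 ∧
      (inducedGIFS S Q).map b = S e.1 := by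
  obtain ⟨k, rfl⟩ := List.mem_iff_get.1 he
  exact ⟨⟨u, k⟩, rfl, rfl, rfl⟩

theorem exists_reverse_edge (b : (inducedGIFS S Q).Edge) :
    ∃ b', (inducedGIFS S Q).src b' = ((inducedGIFS S Q).src b).rev ∧
      (inducedGIFS S Q).tgt b' = ((inducedGIFS S Q).tgt b).rev ∧
      (inducedGIFS S Q).map b' = (inducedGIFS S Q).map b :=
  exists_edge_of_mem_fineSubstitution S (mem_fineSubstitution_rev.2 (List.get_mem _ b.2))

theorem reflTransGen_adj_rev (h : ReflTransGen (inducedGIFS S Q).Adj u v) :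
    ReflTransGen (inducedGIFS S Q).Adj u.rev v.rev := by
  refine h.lift OrientedEdge.rev ?_
  rintro _ _ ⟨b, rfl, rfl⟩
  obtain ⟨b', hsrc, htgt, -⟩ := exists_reverse_edge b
  exact ⟨b', hsrc, htgt⟩

theorem exists_adj_of_mem_coarseSubstitution (S : IFS d N) {i j : Fin m}
    (h : i ∈ coarseSubstitution Q j) (ε : ℤˣ) : ∃ δ, (inducedGIFS S Q).Adj (j, ε) (i, δ) := by
  obtain ⟨e, he, rfl⟩ := List.mem_map.1 h
  have hmem : (e.1, e.2.1, ε * e.2.2) ∈ fineSubstitution Q (j, ε) :=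
    mem_fineSubstitution.2 (by simpa [← mul_assoc] using he)
  obtain ⟨b, hsrc, htgt, -⟩ := exists_edge_of_mem_fineSubstitution S hmem
  exact ⟨_, b, hsrc, htgt⟩

theorem exists_reflTransGen_of_mem_iterate (S : IFS d N) {n : ℕ} {i j : Fin m}
    (h : i ∈ (fun w : List (Fin m) => w.flatMap (coarseSubstitution Q))^[n] [j]) (ε : ℤˣ) :
    ∃ δ, ReflTransGen (inducedGIFS S Q).Adj (j, ε) (i, δ) := by
  induction n generalizing i with
  | zero =>
    obtain rfl : i = j := by simpa using h
    exact ⟨ε, .refl⟩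
  | succ n ih =>
    rw [Function.iterate_succ_apply', List.mem_flatMap] at h
    obtain ⟨k, hk, hi⟩ := h
    obtain ⟨γ, hγ⟩ := ih hk
    obtain ⟨δ, hδ⟩ := exists_adj_of_mem_coarseSubstitution S hi γ
    exact ⟨δ, hγ.tail hδ⟩

theorem reflTransGen_adj_or_rev (hirr : IsIrreducibleSubstitution (coarseSubstitution Q))
    (u v : OrientedEdge m) : ReflTransGen (inducedGIFS S Q).Adj u v ∨
      ReflTransGen (inducedGIFS S Q).Adj u v.rev := by
  obtain ⟨n, hn⟩ := hirr v.1 u.1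
  obtain ⟨δ, hδ⟩ := exists_reflTransGen_of_mem_iterate S hn u.2
  by_cases hv : δ = v.2
  · subst hv
    exact Or.inl hδ
  · obtain rfl := Int.units_ne_iff_eq_neg.1 hv
    exact Or.inr hδ

theorem reflTransGen_adj_symm (hirr : IsIrreducibleSubstitution (coarseSubstitution Q))
    (huv : ReflTransGen (inducedGIFS S Q).Adj u v) : ReflTransGen (inducedGIFS S Q).Adj v u := by
  rcases reflTransGen_adj_or_rev hirr v u with h | h
  · exact h
  · have h_rev := (reflTransGen_adj_rev huv).trans (reflTransGen_adj_rev h)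
    rw [OrientedEdge.rev_rev] at h_rev
    exact h.trans h_rev

variable {E : OrientedEdge m → Set (EuclideanSpace ℝ (Fin d))}

theorem invariantFamily_subset_rev (hE : (inducedGIFS S Q).IsInvariantFamily E)
    (u : OrientedEdge m) : E u ⊆ E u.rev := by
  refine hE.subset_of_mapsTo (F := fun u => E u.rev) (fun u => (hE.1 _).1)
    (fun u => (hE.1 _).2.isClosed) (fun b => ?_) u
  obtain ⟨b', hsrc, htgt, hmap⟩ := exists_reverse_edge b
  have hmaps := hE.mapsTo b'
  rwa [hsrc, htgt, hmap] at hmaps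

theorem hausdorffMeasure_invariantFamily_pos
    (hirr : IsIrreducibleSubstitution (coarseSubstitution Q))
    (hE : (inducedGIFS S Q).IsInvariantFamily E) {s : ℝ} (hs : 0 ≤ s) (hv : 0 < μH[s] (E v))
    (u : OrientedEdge m) : 0 < μH[s] (E u) := by
  rcases reflTransGen_adj_or_rev hirr u v with h | h
  · exact hE.hausdorffMeasure_pos_of_reflTransGen hs h hv
  · exact hE.hausdorffMeasure_pos_of_reflTransGen hs h
      (hv.trans_le (measure_mono (invariantFamily_subset_rev hE v)))

end Induced

end SpaceFilling

theorem mainTheorem2_general {d N m : ℕ} {S : IFS d N} {K : Set (EuclideanSpace ℝ (Fin d))}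
    (hK : S.IsInvariantSet K) (hS : S.OpenSetCondition) {β : Fin N → ℤˣ}
    {Q : Fin m → List (CopyEdge N m)} (hQ : (List.ofFn Q).flatten.Nodup)
    (hmem : ∀ e, e ∈ (List.ofFn Q).flatten ↔ e ∈ orientedGraph β)
    (hirr : IsIrreducibleSubstitution (coarseSubstitution Q))
    {E : OrientedEdge m → Set (EuclideanSpace ℝ (Fin d))}
    (hE : (inducedGIFS S Q).IsInvariantFamily E) :
    (inducedGIFS S Q).OpenSetCondition ∧
      ∃ s : ℝ≥0, (s : ENNReal) = dimH K ∧
        ∀ v, 0 < μH[(s : ℝ)] (E v) ∧ μH[(s : ℝ)] (E v) < ⊤ := by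
  have hlift : (inducedGIFS S Q).IsLift S (inducedLabel S Q) := inducedGIFS_isLift hQ hmem
  refine ⟨hlift.openSetCondition hE hK hS fun b =>
    reflTransGen_adj_symm hirr (.single ⟨b, rfl, rfl⟩), ?_⟩
  obtain ⟨s, hdim, hpos, htop⟩ := hK.exists_dimH_eq_and_hausdorffMeasure_pos_lt_top hS
  refine ⟨s, hdim.symm, fun u =>
    ⟨?_, (MeasureTheory.measure_mono (hlift.subset_invariantSet hE hK u)).trans_lt htop⟩⟩
  have : Nonempty (OrientedEdge m) := ⟨u⟩
  obtain ⟨v, hv⟩ := hlift.exists_hausdorffMeasure_pos hE hK hpos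
  exact hausdorffMeasure_invariantFamily_pos hirr hE s.2 hv u

theorem mainTheorem2 {d N m : ℕ} [NeZero m]
    (S : IFS d N) (K : Set (EuclideanSpace ℝ (Fin d))) (hK : S.IsInvariantSet K)
    (hOSC : S.OpenSetCondition)
    (a : Fin m → EuclideanSpace ℝ (Fin d)) (ha : Function.Injective a)
    (hA : S.IsSkeleton K (Set.range a))
    (β : Fin N → ℤˣ) (P : List (CopyEdge N m)) (Q : Fin m → List (CopyEdge N m))
    (hcons : IsConsistentPartition S a β P Q)
    (hprim : IsPrimitivePartition Q)
    (E : OrientedEdge m → Set (EuclideanSpace ℝ (Fin d)))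
    (hE : (inducedGIFS S Q).IsInvariantFamily E) :
    (inducedGIFS S Q).OpenSetCondition ∧
      ∃ s : ℝ≥0, (s : ENNReal) = dimH K ∧
        ∀ v, 0 < μH[(s : ℝ)] (E v) ∧ μH[(s : ℝ)] (E v) < ⊤ :=
  mainTheorem2_general hK hOSC (hcons.eq_concat ▸ hcons.unicursal.2.1)
    (hcons.eq_concat ▸ hcons.unicursal.2.2) hprim.isIrreducibleSubstitution hE
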